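/- Let $N\ge 2$ and let $\Omega\subset\mathbb R^N$ be a bounded domain (open and connected) which contains the origin, is symmetric with respect to the hyperplane $\{x_1=0\}$, and is convex in the $x_1$-direction (every segment parallel to the $x_1$-axis with end points in $\Omega$ is contained in $\Omega$). Let $k>1$, $p>k+1$ and $a(s)=1+|s|^k$ for $s\in\mathbb R$. Let $\psi:\mathbb R^N\to[0,\infty)$ be continuous, even in the variable $x_1$, and increasing (not necessarily strictly) in the variable $x_1$ on $\{x\in\Omega: x_1<0\}$. Let $u\in C^2(\Omega)\cap C(\overline\Omega)$ be a classical solution of $$ \begin{cases} -\operatorname{div}(a(u)Du)+\dfrac{a'(u)}{2}|Du|^2=\psi(x)\,u^{p} & \text{in }\Omega,\\ u>0 & \text{in }\Omega,\\ u=0 & \text{on }\partial\Omega. \end{cases} $$ Then $u$ is symmetric with respect to $x_1$, that is, $$u(-x_1,x_2,\dots,x_N)=u(x_1,x_2,\dots,x_N)\qquad\text{for all }x\in\overline\Omega .$$ -/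

import Mathlib

noncomputable section

/-- The reflection `(x₁, x₂, …, x_N) ↦ (-x₁, x₂, …, x_N)` of `ℝ^N` in the hyperplane `{x₁ = 0}`
(the coordinate `x₁` has index `0` in `Fin N`). -/
def reflectFirst {N : ℕ} [NeZero N] (x : EuclideanSpace ℝ (Fin N)) :
    EuclideanSpace ℝ (Fin N) :=
  WithLp.toLp 2 (fun j => if j = 0 then -x j else x j)

/-- `x` and `y` lie on a common line parallel to the `x₁`-axis. -/
def SameFiber {N : ℕ} [NeZero N] (x y : EuclideanSpace ℝ (Fin N)) : Prop :=
  ∀ j : Fin N, j ≠ 0 → x j = y j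

/-- `Ω` is convex in the `x₁`-direction: any segment parallel to the `x₁`-axis with end points
in `Ω` lies in `Ω`. -/
def ConvexInFirst {N : ℕ} [NeZero N] (Ω : Set (EuclideanSpace ℝ (Fin N))) : Prop :=
  ∀ x ∈ Ω, ∀ y ∈ Ω, SameFiber x y → segment ℝ x y ⊆ Ω

/-- `f` is increasing (in the weak sense) in the variable `x₁` on the set `S`. -/
def MonotoneInFirstOn {N : ℕ} [NeZero N] (f : EuclideanSpace ℝ (Fin N) → ℝ)
    (S : Set (EuclideanSpace ℝ (Fin N))) : Prop :=
  ∀ x ∈ S, ∀ y ∈ S, SameFiber x y → x 0 ≤ y 0 → f x ≤ f y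

/-- The divergence `∑ⱼ ∂ⱼ Fⱼ` of a vector field on `ℝ^N`. -/
def divergence {N : ℕ} (F : EuclideanSpace ℝ (Fin N) → EuclideanSpace ℝ (Fin N))
    (x : EuclideanSpace ℝ (Fin N)) : ℝ :=
  ∑ j : Fin N, fderiv ℝ (fun y => F y j) x (EuclideanSpace.single j 1)

/-- The quasi-linear operator `-div(a(u) Du) + (a'(u)/2) |Du|²`. -/
def quasilinearOp {N : ℕ} (a : ℝ → ℝ) (u : EuclideanSpace ℝ (Fin N) → ℝ)
    (x : EuclideanSpace ℝ (Fin N)) : ℝ :=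
  -divergence (fun y => a (u y) • gradient u y) x + deriv a (u x) / 2 * ‖gradient u x‖ ^ 2

/-- `u ∈ C²(Ω) ∩ C(closure Ω)` is a classical positive solution of
`-div(a(u) Du) + (a'(u)/2) |Du|² = f(x,u)` in `Ω`, `u > 0` in `Ω`, `u = 0` on `∂Ω`. -/
structure IsPositiveSolution {N : ℕ} (Ω : Set (EuclideanSpace ℝ (Fin N))) (a : ℝ → ℝ)
    (f : EuclideanSpace ℝ (Fin N) → ℝ → ℝ) (u : EuclideanSpace ℝ (Fin N) → ℝ) : Prop where
  contDiffOn : ContDiffOn ℝ 2 u Ω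
  continuousOn : ContinuousOn u (closure Ω)
  equation : ∀ x ∈ Ω, quasilinearOp a u x = f x (u x)
  pos : ∀ x ∈ Ω, 0 < u x
  boundary : ∀ x ∈ frontier Ω, u x = 0

end

/-! The substitution `V = A(u)` with `A' = √a`, `A 0 = 0` turns the equation into `-ΔV = ψ(x) G(V)`,
where `G(s) = g(A⁻¹ s)` and `g(s) = s^p / √(1 + |s|^k)` (`sqrt_mul_coordLaplacian_comp`,
`exists_isSemilinearSolution`). On `[0, ∞)`, `G` is nonnegative, nondecreasing and locally
Lipschitz, with Lipschitz constant tending to zero near zero. Since `A` is injective, symmetry of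
`V` gives that of `u`.

For `V`, extended by zero, the method of moving planes applies. Let `T` be the reflection in `{x₁ =
l}`, `l < 0`, and let `w = V ∘ T - V` on the cap `{x ∈ Ω : x₁ < l}`. Monotonicity and evenness of
`ψ` give `Δw ≤ ψ (G(V) - G(V ∘ T))`. A slab barrier shows that if `w` is negative anywhere, it is
negative at a point a fixed distance from the plane where `V` is bounded below, uniformly in `l`
(`exists_uniform_violation`). So if bad positions exist, compactness at their infimum `l₀` yields an
interior point of the cap with `w ≤ 0`, while `w ≥ 0` throughout by passing to the limit from `l <
l₀`. Taking the infimum covers both the start and the continuation of the motion.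

The contact is excluded by `ne_zero_of_nonneg`: when `w ≥ 0`, monotonicity of `G` makes `w`
superharmonic, so zeros propagate leftwards along the fibre to a point outside `Ω` whose reflection
lies in `Ω`, where `V > 0`. Hence `w ≥ 0` for all `l < 0`. Letting `l → 0` and repeating the
argument for the reflected solution gives equality. -/

open Filter Topology Set

/-! ### Second derivatives along coordinate lines and barrier functions -/

noncomputable section

/-- The second derivative of `V` at `x` in the direction of the `j`-th coordinate vector. -/
def secondPartial {N : ℕ} (V : EuclideanSpace ℝ (Fin N) → ℝ) (j : Fin N)
    (x : EuclideanSpace ℝ (Fin N)) : ℝ :=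
  iteratedDeriv 2 (fun t : ℝ => V (x + t • EuclideanSpace.single j (1 : ℝ))) 0

/-- The Laplacian as the sum of the unmixed second partial derivatives. -/
def coordLaplacian {N : ℕ} (V : EuclideanSpace ℝ (Fin N) → ℝ)
    (x : EuclideanSpace ℝ (Fin N)) : ℝ :=
  ∑ j : Fin N, secondPartial V j x

end

theorem iteratedDeriv_two_eq_of_hasDerivAt {f f' : ℝ → ℝ} {t c : ℝ}
    (hf : ∀ᶠ s in 𝓝 t, HasDerivAt f (f' s) s) (hf' : HasDerivAt f' c t) :
    iteratedDeriv 2 f t = c := by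
  rw [iteratedDeriv_succ, iteratedDeriv_one]
  have : deriv f =ᶠ[𝓝 t] f' := hf.mono fun s hs => hs.deriv
  rw [this.deriv_eq, hf'.deriv]

/-- A negative second derivative at the critical point would make it a local maximum too; then `f`
is locally constant and its second derivative is zero. -/
theorem iteratedDeriv_two_nonneg_of_isLocalMin {f : ℝ → ℝ} {t : ℝ} (hmin : IsLocalMin f t)
    (hc : ContinuousAt f t) : 0 ≤ iteratedDeriv 2 f t := by
  rw [iteratedDeriv_succ, iteratedDeriv_one]
  by_contra! h
  have hmax : IsLocalMax f t := isLocalMax_of_deriv_deriv_neg h hmin.deriv_eq_zero hc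
  have hconst : f =ᶠ[𝓝 t] fun _ => f t := by
    filter_upwards [hmin, hmax] with s h1 h2 using le_antisymm h2 h1
  have : deriv f =ᶠ[𝓝 t] fun _ => 0 := by
    filter_upwards [hconst.deriv] with s hs
    rw [hs]; simp
  rw [this.deriv_eq] at h
  simp at h

section

variable {N : ℕ}

theorem contDiffAt_line {V : EuclideanSpace ℝ (Fin N) → ℝ} {x : EuclideanSpace ℝ (Fin N)}
    {n : WithTop ℕ∞} (hV : ContDiffAt ℝ n V x) (e : EuclideanSpace ℝ (Fin N)) :
    ContDiffAt ℝ n (fun t : ℝ => V (x + t • e)) 0 := by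
  have h : ContDiffAt ℝ n (fun t : ℝ => x + t • e) 0 := by fun_prop
  exact ContDiffAt.comp (0 : ℝ) (by simpa using hV) h

theorem tendsto_line (x e : EuclideanSpace ℝ (Fin N)) :
    Tendsto (fun t : ℝ => x + t • e) (𝓝 0) (𝓝 x) := by
  have h : Continuous (fun t : ℝ => x + t • e) := by fun_prop
  simpa using h.tendsto 0

theorem secondPartial_nonneg_of_isLocalMin {V : EuclideanSpace ℝ (Fin N) → ℝ}
    {x : EuclideanSpace ℝ (Fin N)} (hmin : IsLocalMin V x) (hc : ContinuousAt V x) (j : Fin N) :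
    0 ≤ secondPartial V j x := by
  have ht := tendsto_line x (EuclideanSpace.single j (1 : ℝ))
  refine iteratedDeriv_two_nonneg_of_isLocalMin ?_ ?_
  · have := ht.eventually hmin
    filter_upwards [this] with t h
    simpa using h
  · exact ContinuousAt.comp_of_eq hc (by fun_prop) (by simp)

theorem coordLaplacian_nonneg_of_isLocalMin {V : EuclideanSpace ℝ (Fin N) → ℝ}
    {x : EuclideanSpace ℝ (Fin N)} (hmin : IsLocalMin V x) (hc : ContinuousAt V x) :
    0 ≤ coordLaplacian V x :=
  Finset.sum_nonneg fun j _ => secondPartial_nonneg_of_isLocalMin hmin hc j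

theorem coordLaplacian_add {V W : EuclideanSpace ℝ (Fin N) → ℝ} {x : EuclideanSpace ℝ (Fin N)}
    (hV : ContDiffAt ℝ 2 V x) (hW : ContDiffAt ℝ 2 W x) :
    coordLaplacian (fun y => V y + W y) x = coordLaplacian V x + coordLaplacian W x := by
  simp only [coordLaplacian, ← Finset.sum_add_distrib, secondPartial]
  exact Finset.sum_congr rfl fun j _ =>
    iteratedDeriv_fun_add (contDiffAt_line hV _) (contDiffAt_line hW _)

theorem coordLaplacian_sub {V W : EuclideanSpace ℝ (Fin N) → ℝ} {x : EuclideanSpace ℝ (Fin N)}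
    (hV : ContDiffAt ℝ 2 V x) (hW : ContDiffAt ℝ 2 W x) :
    coordLaplacian (fun y => V y - W y) x = coordLaplacian V x - coordLaplacian W x := by
  simp only [coordLaplacian, ← Finset.sum_sub_distrib, secondPartial]
  exact Finset.sum_congr rfl fun j _ =>
    iteratedDeriv_fun_sub (contDiffAt_line hV _) (contDiffAt_line hW _)

theorem coordLaplacian_congr {V W : EuclideanSpace ℝ (Fin N) → ℝ} {x : EuclideanSpace ℝ (Fin N)}
    (h : V =ᶠ[𝓝 x] W) : coordLaplacian V x = coordLaplacian W x := by
  refine Finset.sum_congr rfl fun j _ => ?_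
  have := (tendsto_line x (EuclideanSpace.single j (1 : ℝ))).eventually h
  exact Filter.EventuallyEq.iteratedDeriv_eq 2 this

/-- `x ↦ c · (3 - exp (m (x₁ - l)))` has Laplacian `-c m² exp (m (x₁ - l))`. -/
theorem coordLaplacian_exp_slab [NeZero N] (c m l : ℝ) (x : EuclideanSpace ℝ (Fin N)) :
    coordLaplacian (fun y : EuclideanSpace ℝ (Fin N) => c * (3 - Real.exp (m * (y 0 - l)))) x =
      -(c * (m ^ 2 * Real.exp (m * (x 0 - l)))) := by
  unfold coordLaplacian
  rw [Finset.sum_eq_single 0]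
  · refine iteratedDeriv_two_eq_of_hasDerivAt
      (f' := fun t => -(c * (m * Real.exp (m * (x 0 + t - l))))) (Eventually.of_forall fun t => ?_) ?_
    · have h : HasDerivAt (fun t : ℝ => m * (x 0 + t - l)) m t := by
        simpa using (((hasDerivAt_id t).const_add (x 0)).sub_const l).const_mul m
      have := (h.exp.const_sub 3).const_mul c
      simp only [PiLp.add_apply, PiLp.smul_apply, smul_eq_mul]
      simp only [PiLp.single_apply, if_true, mul_one]
      exact this.congr_deriv (by ring)
    · have h : HasDerivAt (fun t : ℝ => m * (x 0 + t - l)) m 0 := by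
        simpa using (((hasDerivAt_id (0 : ℝ)).const_add (x 0)).sub_const l).const_mul m
      have := ((h.exp.const_mul m).const_mul c).neg
      exact this.congr_deriv (by simp only [add_zero]; ring)
  · intro j _ hj
    refine iteratedDeriv_two_eq_of_hasDerivAt (f' := fun _ => 0)
      (Eventually.of_forall fun t => ?_) (hasDerivAt_const _ _)
    simp only [PiLp.add_apply, PiLp.smul_apply, smul_eq_mul]
    simp [Ne.symm hj, hasDerivAt_const]
  · simp

/-- Barrier for the strong minimum principle: for `c, α > 0` it is strictly subharmonic where `2 α
‖x - z‖² > N`. -/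
theorem coordLaplacian_gaussian (c α : ℝ) (z x : EuclideanSpace ℝ (Fin N)) (b : ℝ) :
    coordLaplacian (fun y => c * (Real.exp (-α * ‖y - z‖ ^ 2) - b)) x =
      c * ((4 * α ^ 2 * ‖x - z‖ ^ 2 - 2 * N * α) * Real.exp (-α * ‖x - z‖ ^ 2)) := by
  have key : ∀ j : Fin N, secondPartial (fun y => c * (Real.exp (-α * ‖y - z‖ ^ 2) - b)) j x =
      c * ((4 * α ^ 2 * (x j - z j) ^ 2 - 2 * α) * Real.exp (-α * ‖x - z‖ ^ 2)) := by
    intro j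
    have hn : ∀ t : ℝ, ‖x + t • EuclideanSpace.single j (1 : ℝ) - z‖ ^ 2 =
        ‖x - z‖ ^ 2 + 2 * t * (x j - z j) + t ^ 2 := by
      intro t
      rw [show x + t • EuclideanSpace.single j (1 : ℝ) - z =
        (x - z) + t • EuclideanSpace.single j (1 : ℝ) by abel, norm_add_sq_real, norm_smul,
        inner_smul_right, EuclideanSpace.inner_single_right]
      simp
      ring
    unfold secondPartial
    simp only [hn]
    have h : ∀ t : ℝ, HasDerivAt (fun t : ℝ => -α * (‖x - z‖ ^ 2 + 2 * t * (x j - z j) + t ^ 2))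
        (-α * (2 * (x j - z j) + 2 * t)) t := by
      intro t
      have h1 : HasDerivAt (fun t : ℝ => 2 * t * (x j - z j)) (2 * (x j - z j)) t := by
        simpa using ((hasDerivAt_id t).const_mul 2).mul_const (x j - z j)
      have h2 : HasDerivAt (fun t : ℝ => t ^ 2) (2 * t) t := by
        simpa using hasDerivAt_pow 2 t
      exact (((h1.const_add (‖x - z‖ ^ 2)).add h2).const_mul (-α))
    refine iteratedDeriv_two_eq_of_hasDerivAt
      (Eventually.of_forall fun t => (((h t).exp.sub_const b).const_mul c)) ?_
    have h3 : HasDerivAt (fun t : ℝ => -α * (2 * (x j - z j) + 2 * t)) (-α * 2) 0 := by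
      simpa using (((hasDerivAt_id (0 : ℝ)).const_mul 2).const_add (2 * (x j - z j))).const_mul (-α)
    have := ((h 0).exp.mul h3).const_mul c
    refine this.congr_deriv ?_
    rw [show -α * (‖x - z‖ ^ 2 + 2 * 0 * (x j - z j) + 0 ^ 2) = -α * ‖x - z‖ ^ 2 by ring]
    ring
  unfold coordLaplacian
  simp only [key]
  rw [← Finset.mul_sum, ← Finset.sum_mul, Finset.sum_sub_distrib, ← Finset.mul_sum,
    EuclideanSpace.norm_sq_eq]
  simp only [PiLp.sub_apply, Real.norm_eq_abs, sq_abs, Finset.sum_const, Finset.card_univ,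
    Fintype.card_fin, nsmul_eq_mul]
  ring

end

/-! ### Strong minimum principle -/

section

variable {N : ℕ}

/-- Strong minimum principle on balls: positivity of a nonnegative superharmonic function at the
centre propagates to the whole ball. -/
theorem pos_on_ball_of_superharmonic {w : EuclideanSpace ℝ (Fin N) → ℝ}
    {z : EuclideanSpace ℝ (Fin N)} {R : ℝ}
    (hc : ContinuousOn w (Metric.closedBall z R))
    (hC2 : ∀ x ∈ Metric.ball z R, ContDiffAt ℝ 2 w x)
    (h0 : ∀ x ∈ Metric.closedBall z R, 0 ≤ w x)
    (hlap : ∀ x ∈ Metric.ball z R, coordLaplacian w x ≤ 0) (hz : 0 < w z) :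
    ∀ x ∈ Metric.ball z R, 0 < w x := by
  intro x hx
  have hR : 0 < R := lt_of_le_of_lt dist_nonneg hx
  have hzc : ContinuousAt w z := (hC2 z (Metric.mem_ball_self hR)).continuousAt
  obtain ⟨ρ', hρ', hwρ'⟩ := Metric.eventually_nhds_iff_ball.1
    (hzc.eventually (lt_mem_nhds (half_lt_self hz)))
  set m := w z / 2 with hm
  have hmpos : 0 < m := by positivity
  obtain ⟨ρ, hρ, hρlt⟩ := exists_between (lt_min hρ' hR)
  have hwρ : ∀ y ∈ Metric.closedBall z ρ, m < w y := fun y hy =>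
    hwρ' y (lt_of_le_of_lt hy (hρlt.trans_le (min_le_left _ _)))
  have hρR : ρ < R := hρlt.trans_le (min_le_right _ _)
  by_cases hxρ : x ∈ Metric.closedBall z ρ
  · exact hmpos.trans (hwρ x hxρ)
  -- Chosen so that the Gaussian is strictly subharmonic outside the ball of radius `ρ`; `b` makes
  -- it vanish on the outer sphere. Then `w + h` is nonnegative on both spheres and has no interior
  -- minimum in the annulus.
  set α : ℝ := (N + 1) / ρ ^ 2 with hα
  have hαpos : 0 < α := by positivity
  have hαρ : α * ρ ^ 2 = N + 1 := by rw [hα]; field_simp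
  set b := Real.exp (-α * R ^ 2) with hb
  set h : EuclideanSpace ℝ (Fin N) → ℝ := fun y => -m * (Real.exp (-α * ‖y - z‖ ^ 2) - b) with hh
  have hhC : ContDiff ℝ 2 h := by
    have : ContDiff ℝ 2 (fun y : EuclideanSpace ℝ (Fin N) => ‖y - z‖ ^ 2) :=
      (contDiff_id.sub contDiff_const).norm_sq ℝ
    exact contDiff_const.mul (((contDiff_const.mul this).exp).sub contDiff_const)
  have hgc : ContinuousOn (fun y => w y + h y) (Metric.closedBall z R \ Metric.ball z ρ) :=
    (hc.mono sdiff_subset).add hhC.continuous.continuousOn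
  have hK : IsCompact (Metric.closedBall z R \ Metric.ball z ρ) :=
    (isCompact_closedBall z R).diff Metric.isOpen_ball
  have hxK : x ∈ Metric.closedBall z R \ Metric.ball z ρ :=
    ⟨Metric.ball_subset_closedBall hx, fun h' => hxρ (Metric.ball_subset_closedBall h')⟩
  obtain ⟨y, hyK, hymin⟩ := hK.exists_isMinOn ⟨x, hxK⟩ hgc
  have hyR : dist y z ≤ R := hyK.1
  have hyρ : ρ ≤ dist y z := not_lt.1 hyK.2
  have hgy : 0 ≤ w y + h y := by
    rcases hyR.eq_or_lt with hyR | hyR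
    · have : h y = 0 := by simp [hh, hb, ← dist_eq_norm, hyR]
      rw [this, add_zero]; exact h0 y hyK.1
    rcases hyρ.eq_or_lt with hyρ | hyρ
    · have h1 : m < w y := hwρ y hyρ.symm.le
      have h2 : Real.exp (-α * ‖y - z‖ ^ 2) ≤ 1 := by
        rw [Real.exp_le_one_iff]
        have : 0 ≤ α * ‖y - z‖ ^ 2 := by positivity
        linarith
      have h3 : 0 < b := Real.exp_pos _
      have : m * (Real.exp (-α * ‖y - z‖ ^ 2) - b) ≤ m * 1 :=
        mul_le_mul_of_nonneg_left (by linarith) hmpos.le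
      simp only [hh]; linarith
    · exfalso
      have hnhds : Metric.closedBall z R \ Metric.ball z ρ ∈ 𝓝 y := by
        have h1 : Metric.ball z R ∈ 𝓝 y := Metric.isOpen_ball.mem_nhds hyR
        have h2 : (Metric.closedBall z ρ)ᶜ ∈ 𝓝 y :=
          Metric.isClosed_closedBall.isOpen_compl.mem_nhds (by simpa using hyρ)
        filter_upwards [h1, h2] with a ha1 ha2
        exact ⟨Metric.ball_subset_closedBall ha1,
          fun h' => ha2 (Metric.ball_subset_closedBall h')⟩
      have hloc : IsLocalMin (fun y => w y + h y) y := hymin.isLocalMin hnhds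
      have hwy := hC2 y hyR
      have hL := coordLaplacian_nonneg_of_isLocalMin hloc
        (hwy.continuousAt.add hhC.continuous.continuousAt)
      rw [coordLaplacian_add hwy hhC.contDiffAt, coordLaplacian_gaussian] at hL
      have hwL := hlap y hyR
      have hr : ρ ^ 2 ≤ ‖y - z‖ ^ 2 := by
        rw [← dist_eq_norm]; exact pow_le_pow_left₀ hρ.le hyρ.le 2
      have h4 : α * ρ ^ 2 ≤ α * ‖y - z‖ ^ 2 := mul_le_mul_of_nonneg_left hr hαpos.le
      have hN : (0 : ℝ) ≤ N := Nat.cast_nonneg N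
      have h5 : 0 < 4 * α ^ 2 * ‖y - z‖ ^ 2 - 2 * N * α := by
        have : 0 < 2 * α * (2 * (α * ‖y - z‖ ^ 2) - N) :=
          mul_pos (by positivity) (by linarith)
        linarith
      have h6 := mul_pos hmpos (mul_pos h5 (Real.exp_pos (-α * ‖y - z‖ ^ 2)))
      linarith
  have hgx : 0 ≤ w x + h x := hgy.trans (hymin hxK)
  have : 0 < Real.exp (-α * ‖x - z‖ ^ 2) - b := by
    rw [sub_pos, hb, Real.exp_lt_exp, ← dist_eq_norm]
    have : dist x z ^ 2 < R ^ 2 := pow_lt_pow_left₀ hx dist_nonneg (by norm_num)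
    have := mul_lt_mul_of_pos_left this hαpos
    linarith
  have := mul_pos hmpos this
  simp only [hh] at hgx
  linarith

/-- A nonnegative superharmonic function on an open set which vanishes at a point vanishes
nearby. -/
theorem eventually_eq_zero_of_superharmonic {w : EuclideanSpace ℝ (Fin N) → ℝ}
    {U : Set (EuclideanSpace ℝ (Fin N))} (hU : IsOpen U)
    (hC2 : ∀ x ∈ U, ContDiffAt ℝ 2 w x) (h0 : ∀ x ∈ U, 0 ≤ w x)
    (hlap : ∀ x ∈ U, coordLaplacian w x ≤ 0) {x : EuclideanSpace ℝ (Fin N)} (hx : x ∈ U)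
    (hwx : w x = 0) : ∀ᶠ y in 𝓝 x, w y = 0 := by
  obtain ⟨r, hr, hball⟩ := Metric.isOpen_iff.1 hU x hx
  -- With radius `r / 3`, the ball around `y` contains `x` while its closure stays in `U`, so `w y >
  -- 0` would propagate to `x`.
  refine Metric.eventually_nhds_iff_ball.2 ⟨r / 3, by positivity, fun y hy => ?_⟩
  have hsub : Metric.closedBall y (r / 3) ⊆ U := fun a ha => hball (by
    have h1 : dist a y ≤ r / 3 := ha
    have h2 : dist y x < r / 3 := hy
    have := dist_triangle a y x
    show dist a x < r
    linarith)
  by_contra hne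
  have hpos : 0 < w y :=
    lt_of_le_of_ne (h0 y (hsub (Metric.mem_closedBall_self (by positivity)))) (Ne.symm hne)
  have := pos_on_ball_of_superharmonic
    (fun a ha => (hC2 a (hsub ha)).continuousAt.continuousWithinAt)
    (fun a ha => hC2 a (hsub (Metric.ball_subset_closedBall ha)))
    (fun a ha => h0 a (hsub ha))
    (fun a ha => hlap a (hsub (Metric.ball_subset_closedBall ha))) hpos x
    (by rw [Metric.mem_ball, dist_comm]; exact hy)
  exact this.ne' hwx

end

/-! ### Reflections and symmetric domains -/

noncomputable section

/-- The reflection of `ℝ^N` in the hyperplane `{x₁ = l}`. -/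
def reflectAt {N : ℕ} [NeZero N] (l : ℝ) (x : EuclideanSpace ℝ (Fin N)) :
    EuclideanSpace ℝ (Fin N) :=
  WithLp.toLp 2 (fun j => if j = 0 then 2 * l - x j else x j)

end

section

variable {N : ℕ} [NeZero N]

@[simp]
theorem reflectAt_apply_zero (l : ℝ) (x : EuclideanSpace ℝ (Fin N)) :
    reflectAt l x 0 = 2 * l - x 0 := by
  simp [reflectAt]

theorem reflectAt_apply_of_ne (l : ℝ) (x : EuclideanSpace ℝ (Fin N)) {j : Fin N} (hj : j ≠ 0) :
    reflectAt l x j = x j := by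
  simp [reflectAt, hj]

theorem reflectAt_zero (x : EuclideanSpace ℝ (Fin N)) : reflectAt 0 x = reflectFirst x := by
  ext j; simp [reflectAt, reflectFirst]

theorem reflectFirst_reflectFirst (x : EuclideanSpace ℝ (Fin N)) :
    reflectFirst (reflectFirst x) = x := by
  ext j; by_cases hj : j = 0 <;> simp [reflectFirst, hj]

theorem reflectAt_of_eq {l : ℝ} {x : EuclideanSpace ℝ (Fin N)} (hx : x 0 = l) :
    reflectAt l x = x := by
  ext j
  by_cases hj : j = 0
  · subst hj; rw [reflectAt_apply_zero, hx]; ring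
  · exact reflectAt_apply_of_ne l x hj

theorem sameFiber_reflectAt (l : ℝ) (x : EuclideanSpace ℝ (Fin N)) :
    SameFiber (reflectAt l x) x := fun _ hj => reflectAt_apply_of_ne l x hj

theorem contDiff_reflectAt (l : ℝ) {n : WithTop ℕ∞} :
    ContDiff ℝ n (reflectAt l : EuclideanSpace ℝ (Fin N) → EuclideanSpace ℝ (Fin N)) := by
  rw [contDiff_euclidean]
  intro j
  by_cases hj : j = 0
  · subst hj; simp only [reflectAt_apply_zero]; fun_prop
  · simp only [reflectAt_apply_of_ne l _ hj]; fun_prop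

theorem continuous_reflectAt_uncurry :
    Continuous (fun q : ℝ × EuclideanSpace ℝ (Fin N) => reflectAt q.1 q.2) := by
  refine (PiLp.continuous_toLp 2 _).comp (continuous_pi fun j => ?_)
  by_cases hj : j = 0
  · simp only [hj, if_true]; fun_prop
  · simp only [hj, if_false]; fun_prop

theorem reflectAt_line (l t : ℝ) (x : EuclideanSpace ℝ (Fin N)) (j : Fin N) :
    reflectAt l (x + t • EuclideanSpace.single j (1 : ℝ)) =
      reflectAt l x + (if j = 0 then -t else t) • EuclideanSpace.single j (1 : ℝ) := by
  ext i
  by_cases hi : i = 0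
  · subst hi
    by_cases hj : j = 0
    · subst hj; simp; ring
    · simp [hj, Ne.symm hj]
  · rw [reflectAt_apply_of_ne _ _ hi]
    by_cases hj : j = 0
    · subst hj; simp [hi, reflectAt_apply_of_ne]
    · simp [hj, hi, reflectAt_apply_of_ne]

/-- A reflection only reverses the parameter on the line in the first direction, which leaves second
derivatives unchanged. -/
theorem coordLaplacian_comp_reflectAt (V : EuclideanSpace ℝ (Fin N) → ℝ) (l : ℝ)
    (x : EuclideanSpace ℝ (Fin N)) :
    coordLaplacian (fun y => V (reflectAt l y)) x = coordLaplacian V (reflectAt l x) := by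
  refine Finset.sum_congr rfl fun j _ => ?_
  unfold secondPartial
  simp only [reflectAt_line]
  by_cases hj : j = 0
  · simp only [hj, if_true]
    have := iteratedDeriv_comp_neg 2
      (fun t : ℝ => V (reflectAt l x + t • EuclideanSpace.single 0 (1 : ℝ))) 0
    simpa using this
  · simp only [hj, if_false]

theorem mem_of_abs_le {Ω : Set (EuclideanSpace ℝ (Fin N))} (hsymm : ∀ x ∈ Ω, reflectFirst x ∈ Ω)
    (hconv : ConvexInFirst Ω) {x y : EuclideanSpace ℝ (Fin N)} (hx : x ∈ Ω) (hxy : SameFiber y x)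
    (h : |y 0| ≤ |x 0|) : y ∈ Ω := by
  by_cases hx0 : x 0 = 0
  · have : y = x := by
      ext j
      by_cases hj : j = 0
      · subst hj
        rw [hx0, abs_zero] at h
        rw [hx0, abs_nonpos_iff.1 h]
      · exact hxy j hj
    rwa [this]
  have hfib : SameFiber x (reflectFirst x) := fun j hj => by simp [reflectFirst, hj]
  refine hconv x hx _ (hsymm x hx) hfib ?_
  have hd : |y 0 / x 0| ≤ 1 := by rw [abs_div]; exact div_le_one_of_le₀ h (abs_nonneg _)
  rw [abs_le] at hd
  -- `y` is a convex combination of `x` and its mirror image; these are the weights.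
  refine ⟨(1 + y 0 / x 0) / 2, (1 - y 0 / x 0) / 2, by linarith, by linarith, by ring, ?_⟩
  ext j
  by_cases hj : j = 0
  · subst hj
    simp [reflectFirst]
    field_simp
    ring
  · simp [reflectFirst, hj, hxy j hj]
    ring

/-- The data of a positive solution `V`, extended by zero, of `-ΔV = ψ(x) G(V)` on a domain which
is symmetric and convex in the first variable. -/
structure IsSemilinearSolution (Ω : Set (EuclideanSpace ℝ (Fin N)))
    (ψ : EuclideanSpace ℝ (Fin N) → ℝ) (G : ℝ → ℝ) (V : EuclideanSpace ℝ (Fin N) → ℝ) : Prop where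
  isOpen : IsOpen Ω
  isBounded : Bornology.IsBounded Ω
  symm : ∀ x ∈ Ω, reflectFirst x ∈ Ω
  conv : ConvexInFirst Ω
  weight_continuous : Continuous ψ
  weight_nonneg : ∀ x, 0 ≤ ψ x
  weight_even : ∀ x, ψ (reflectFirst x) = ψ x
  weight_mono : MonotoneInFirstOn ψ {x ∈ Ω | x 0 < 0}
  reaction_nonneg : ∀ s, 0 ≤ s → 0 ≤ G s
  reaction_mono : ∀ s t, 0 ≤ s → s ≤ t → G s ≤ G t
  -- One-sided bounds suffice: they are only applied where `V (T x) < V x`.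
  reaction_lip : ∀ M, ∃ L, ∀ s t, 0 ≤ s → s ≤ t → t ≤ M → G t - G s ≤ L * (t - s)
  reaction_small : ∀ δ > 0, ∃ η > 0, ∀ s t, 0 ≤ s → s ≤ t → t ≤ η → G t - G s ≤ δ * (t - s)
  continuous : Continuous V
  eq_zero : ∀ x, x ∉ Ω → V x = 0
  pos : ∀ x ∈ Ω, 0 < V x
  contDiffAt : ∀ x ∈ Ω, ContDiffAt ℝ 2 V x
  equation : ∀ x ∈ Ω, -coordLaplacian V x = ψ x * G (V x)

/-! ### Moving planes for the semilinear equation -/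

namespace IsSemilinearSolution

variable {Ω : Set (EuclideanSpace ℝ (Fin N))} {ψ : EuclideanSpace ℝ (Fin N) → ℝ} {G : ℝ → ℝ}
  {V : EuclideanSpace ℝ (Fin N) → ℝ}

theorem nonneg (h : IsSemilinearSolution Ω ψ G V) (x : EuclideanSpace ℝ (Fin N)) : 0 ≤ V x := by
  by_cases hx : x ∈ Ω
  · exact (h.pos x hx).le
  · exact (h.eq_zero x hx).ge

theorem reflectAt_mem (h : IsSemilinearSolution Ω ψ G V) {l : ℝ} (hl : l < 0)
    {x : EuclideanSpace ℝ (Fin N)} (hx : x ∈ Ω) (hxl : x 0 < l) : reflectAt l x ∈ Ω := by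
  refine mem_of_abs_le h.symm h.conv hx (sameFiber_reflectAt l x) ?_
  rw [reflectAt_apply_zero, abs_of_neg (hxl.trans hl), abs_le]
  constructor <;> linarith

/-- Monotonicity is only given for `x₁ < 0`; approaching `y` from the left and using continuity
includes `y 0 = 0`. -/
theorem weight_le (h : IsSemilinearSolution Ω ψ G V) {x y : EuclideanSpace ℝ (Fin N)}
    (hx : x ∈ Ω) (hxy : SameFiber y x) (hx0 : x 0 < y 0) (hy0 : y 0 ≤ 0) : ψ x ≤ ψ y := by
  have hlim : Tendsto (fun s : ℝ => ψ (y + s • EuclideanSpace.single 0 (1 : ℝ))) (𝓝[<] 0)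
      (𝓝 (ψ y)) :=
    ((h.weight_continuous.tendsto y).comp (tendsto_line y _)).mono_left nhdsWithin_le_nhds
  refine ge_of_tendsto hlim ?_
  have : Ioo (x 0 - y 0) 0 ∈ 𝓝[<] (0 : ℝ) := Ioo_mem_nhdsLT (by linarith)
  filter_upwards [this] with s hs
  set z := y + s • EuclideanSpace.single 0 (1 : ℝ) with hz
  have hz0 : z 0 = y 0 + s := by simp [hz]
  have hzf : SameFiber z x := fun j hj => by simp [hz, hj, hxy j hj]
  have hzΩ : z ∈ Ω := by
    refine mem_of_abs_le h.symm h.conv hx hzf ?_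
    rw [hz0, abs_of_neg (by linarith [hs.2] : y 0 + s < 0), abs_of_neg (hx0.trans_le hy0)]
    linarith [hs.1]
  exact h.weight_mono x ⟨hx, hx0.trans_le hy0⟩ z ⟨hzΩ, by rw [hz0]; linarith [hs.2]⟩
    (fun j hj => (hzf j hj).symm) (by rw [hz0]; linarith [hs.1])

theorem weight_le_reflectAt (h : IsSemilinearSolution Ω ψ G V) {l : ℝ} (hl : l < 0)
    {x : EuclideanSpace ℝ (Fin N)} (hx : x ∈ Ω) (hxl : x 0 < l) : ψ x ≤ ψ (reflectAt l x) := by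
  rcases le_total (reflectAt l x 0) 0 with h0 | h0
  · exact h.weight_le hx (sameFiber_reflectAt l x) (by rw [reflectAt_apply_zero]; linarith) h0
  -- Across the origin, evenness replaces the reflected point by one with first coordinate `x 0 - 2
  -- * l`, still to the right of `x`.
  · rw [← h.weight_even (reflectAt l x)]
    rw [reflectAt_apply_zero] at h0
    have e : reflectFirst (reflectAt l x) 0 = -(2 * l - x 0) := by simp [reflectFirst]
    refine h.weight_le hx (fun j hj => ?_) (by rw [e]; linarith) (by rw [e]; linarith)
    simp [reflectFirst, hj, reflectAt_apply_of_ne]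

theorem contDiffAt_sub (h : IsSemilinearSolution Ω ψ G V) {l : ℝ} (hl : l < 0)
    {x : EuclideanSpace ℝ (Fin N)} (hx : x ∈ Ω) (hxl : x 0 < l) :
    ContDiffAt ℝ 2 (fun y => V (reflectAt l y) - V y) x :=
  ((h.contDiffAt _ (h.reflectAt_mem hl hx hxl)).comp x (contDiff_reflectAt l).contDiffAt).sub
    (h.contDiffAt x hx)

theorem coordLaplacian_sub_le (h : IsSemilinearSolution Ω ψ G V) {l : ℝ} (hl : l < 0)
    {x : EuclideanSpace ℝ (Fin N)} (hx : x ∈ Ω) (hxl : x 0 < l) :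
    coordLaplacian (fun y => V (reflectAt l y) - V y) x ≤
      ψ x * (G (V x) - G (V (reflectAt l x))) := by
  have hT := h.reflectAt_mem hl hx hxl
  rw [coordLaplacian_sub (V := fun y => V (reflectAt l y)) ((h.contDiffAt _ hT).comp x (contDiff_reflectAt l).contDiffAt)
    (h.contDiffAt x hx), coordLaplacian_comp_reflectAt]
  have h1 := h.equation x hx
  have h2 := h.equation _ hT
  have h3 := mul_le_mul_of_nonneg_right (h.weight_le_reflectAt hl hx hxl)
    (h.reaction_nonneg _ (h.pos _ hT).le)
  linarith

/-- A violation of the reflection inequality occurs at a point which is a definite distance away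
from the reflection hyperplane and where `V` is bounded below. -/
theorem exists_uniform_violation (h : IsSemilinearSolution Ω ψ G V) :
    ∃ ε > 0, ∃ η > 0, ∀ l < 0, (∃ x ∈ Ω, x 0 < l ∧ V (reflectAt l x) < V x) →
      ∃ x ∈ Ω, x 0 ≤ l - ε ∧ η ≤ V x ∧ V (reflectAt l x) < V x := by
  have hcl : IsCompact (closure Ω) := h.isBounded.isCompact_closure
  obtain ⟨R, hR⟩ := h.isBounded.exists_norm_le
  have hR0 : ∀ x ∈ Ω, -R ≤ x 0 := fun x hx =>
    (abs_le.1 ((PiLp.norm_apply_le x 0).trans (hR x hx))).1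
  obtain ⟨M, hM⟩ := (hcl.image h.continuous).bddAbove
  have hM' : ∀ x ∈ Ω, V x ≤ M := fun x hx => hM ⟨x, subset_closure hx, rfl⟩
  obtain ⟨P, hP⟩ := (hcl.image h.weight_continuous).bddAbove
  set Q := max P 1 with hQ
  have hQpos : 0 < Q := lt_of_lt_of_le one_pos (le_max_right _ _)
  have hψQ : ∀ x ∈ Ω, ψ x ≤ Q := fun x hx =>
    (hP ⟨x, subset_closure hx, rfl⟩).trans (le_max_left _ _)
  obtain ⟨L₀, hL₀⟩ := h.reaction_lip M
  set L := max L₀ 0 with hL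
  have hLnn : 0 ≤ L := le_max_right _ _
  -- On the cap `0 < φ < 3` and `-Δφ = m² exp (m (x₁ - l))`. This `m` beats the full Lipschitz
  -- constant in the strip of width `1 / m`, where the exponential exceeds `exp (-1)`; `δ` below is
  -- small enough to be beaten anywhere, since `x₁ - l ≥ -R`.
  set m := 3 * Real.exp 1 * (Q * L) + 1 with hm
  have hm1 : 1 ≤ m := by
    have : 0 ≤ 3 * Real.exp 1 * (Q * L) := by positivity
    linarith
  have hmpos : 0 < m := by linarith
  set δ := m ^ 2 * Real.exp (-(m * R)) / (6 * Q) with hδ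
  have hδpos : 0 < δ := by positivity
  obtain ⟨η, hη, hGη⟩ := h.reaction_small δ hδpos
  refine ⟨1 / m, by positivity, η, hη, fun l hl ⟨x₁, hx₁, hx₁l, hx₁w⟩ => ?_⟩
  set w : EuclideanSpace ℝ (Fin N) → ℝ := fun y => V (reflectAt l y) - V y with hw
  have hwc : Continuous w :=
    (h.continuous.comp (contDiff_reflectAt (n := 0) l).continuous).sub h.continuous
  set φ : EuclideanSpace ℝ (Fin N) → ℝ := fun y => 3 - Real.exp (m * (y 0 - l)) with hφ
  have hφC : ContDiff ℝ 2 φ := by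
    have : ContDiff ℝ 2 (fun y : EuclideanSpace ℝ (Fin N) => m * (y 0 - l)) := by fun_prop
    exact contDiff_const.sub this.exp
  set K : Set (EuclideanSpace ℝ (Fin N)) := closure Ω ∩ {y | y 0 ≤ l} with hK
  have hφpos : ∀ y ∈ K, 0 < φ y := fun y hy => by
    have : Real.exp (m * (y 0 - l)) ≤ 1 := by
      rw [Real.exp_le_one_iff]
      exact mul_nonpos_of_nonneg_of_nonpos hmpos.le (sub_nonpos.2 hy.2)
    simp only [hφ]; linarith
  have hφ3 : ∀ y, φ y < 3 := fun y => by
    have := Real.exp_pos (m * (y 0 - l))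
    simp only [hφ]; linarith
  have hKc : IsCompact K := hcl.inter_right (isClosed_le (by fun_prop) continuous_const)
  obtain ⟨x, hxK, hxmin⟩ := hKc.exists_isMinOn ⟨x₁, subset_closure hx₁, hx₁l.le⟩
    (hwc.continuousOn.div hφC.continuous.continuousOn fun y hy => (hφpos y hy).ne')
  have hφx := hφpos x hxK
  have hqx : w x / φ x < 0 :=
    lt_of_le_of_lt (hxmin (show x₁ ∈ K from ⟨subset_closure hx₁, hx₁l.le⟩))
      (div_neg_of_neg_of_pos (sub_neg.2 hx₁w) (hφpos x₁ ⟨subset_closure hx₁, hx₁l.le⟩))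
  -- With this `μ`, `w + μ φ` is nonnegative on `K` and vanishes at the minimizer `x`. If the
  -- conclusion failed at `x`, its Laplacian there would be negative.
  set μ := -(w x / φ x) with hμ
  have hμpos : 0 < μ := by rw [hμ]; linarith
  have hwx : w x = -(μ * φ x) := by rw [hμ]; field_simp
  have hwx0 : w x < 0 := by rw [hwx]; have := mul_pos hμpos hφx; linarith
  have hxw : V (reflectAt l x) < V x := sub_neg.1 hwx0
  have hxΩ : x ∈ Ω := by
    by_contra hx
    rw [h.eq_zero x hx] at hxw
    exact (h.nonneg _).not_gt hxw
  have hxl : x 0 < l := by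
    refine lt_of_le_of_ne hxK.2 fun he => ?_
    rw [reflectAt_of_eq he] at hxw
    exact lt_irrefl _ hxw
  refine ⟨x, hxΩ, ?_⟩
  by_contra! hcon
  have key : ∃ c : ℝ, G (V x) - G (V (reflectAt l x)) ≤ c * (V x - V (reflectAt l x)) ∧
      ψ x * c * φ x < m ^ 2 * Real.exp (m * (x 0 - l)) := by
    have hψx := h.weight_nonneg x
    by_cases hnear : x 0 ≤ l - 1 / m
    · have hVη : V x < η := by
        by_contra! hge
        exact (hcon hnear hge).not_gt hxw
      refine ⟨δ, hGη _ _ (h.nonneg _) hxw.le hVη.le, ?_⟩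
      have h1 : ψ x * δ * φ x ≤ Q * δ * 3 := by
        gcongr
        · exact hψQ x hxΩ
        · exact (hφ3 x).le
      have h2 : Q * δ * 3 = m ^ 2 * Real.exp (-(m * R)) / 2 := by
        rw [hδ]; field_simp; ring
      have h3 : Real.exp (-(m * R)) ≤ Real.exp (m * (x 0 - l)) := by
        rw [Real.exp_le_exp, ← mul_neg]
        exact mul_le_mul_of_nonneg_left (by linarith [hR0 x hxΩ]) hmpos.le
      have h4 := mul_le_mul_of_nonneg_left h3 (sq_nonneg m)
      have h5 : 0 < m ^ 2 * Real.exp (-(m * R)) := by positivity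
      linarith
    · refine ⟨L, (hL₀ _ _ (h.nonneg _) hxw.le (hM' x hxΩ)).trans
        (mul_le_mul_of_nonneg_right (le_max_left _ _) (sub_nonneg.2 hxw.le)), ?_⟩
      have h1 : ψ x * L * φ x ≤ Q * L * 3 := by
        gcongr
        · exact hψQ x hxΩ
        · exact (hφ3 x).le
      have h3 : Real.exp (-1) ≤ Real.exp (m * (x 0 - l)) := by
        rw [Real.exp_le_exp]
        have : m * (-(1 / m)) ≤ m * (x 0 - l) :=
          mul_le_mul_of_nonneg_left (by linarith) hmpos.le
        have e : m * (-(1 / m)) = -1 := by field_simp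
        linarith
      have h4 := mul_le_mul_of_nonneg_left h3 (sq_nonneg m)
      have h5 : Q * L * 3 < m ^ 2 * Real.exp (-1) := by
        have h6 : 3 * Real.exp 1 * (Q * L) < m ^ 2 := by
          have : m * 1 ≤ m * m := mul_le_mul_of_nonneg_left hm1 hmpos.le
          rw [sq]; linarith
        have h7 := mul_lt_mul_of_pos_right h6 (Real.exp_pos (-1))
        have h8 : Real.exp 1 * Real.exp (-1) = 1 := by rw [← Real.exp_add]; simp
        calc Q * L * 3 = 3 * (Q * L) * (Real.exp 1 * Real.exp (-1)) := by rw [h8]; ring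
          _ = 3 * Real.exp 1 * (Q * L) * Real.exp (-1) := by ring
          _ < _ := h7
      linarith
  obtain ⟨c, hc1, hc2⟩ := key
  have hnhds : K ∈ 𝓝 x := by
    have h1 : {y : EuclideanSpace ℝ (Fin N) | y 0 < l} ∈ 𝓝 x :=
      (isOpen_lt (by fun_prop) continuous_const).mem_nhds hxl
    filter_upwards [h.isOpen.mem_nhds hxΩ, h1] with y hy1 hy2
    exact ⟨subset_closure hy1, le_of_lt hy2⟩
  have hloc : IsLocalMin (fun y => w y + μ * φ y) x := by
    filter_upwards [hnhds] with y hy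
    have h1 : w x / φ x ≤ w y / φ y := hxmin hy
    have h2 : -μ ≤ w y / φ y := by rw [hμ, neg_neg]; exact h1
    rw [le_div_iff₀ (hφpos y hy)] at h2
    rw [hwx]; linarith
  have hwC := h.contDiffAt_sub hl hxΩ hxl
  have hμφC : ContDiffAt ℝ 2 (fun y => μ * φ y) x := contDiffAt_const.mul hφC.contDiffAt
  have hLap := coordLaplacian_nonneg_of_isLocalMin hloc
    (hwC.continuousAt.add hμφC.continuousAt)
  rw [coordLaplacian_add hwC hμφC, coordLaplacian_exp_slab] at hLap
  have h1 := h.coordLaplacian_sub_le hl hxΩ hxl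
  have h2 := mul_le_mul_of_nonneg_left hc1 (h.weight_nonneg x)
  have h3 : ψ x * (c * (V x - V (reflectAt l x))) = μ * (ψ x * c * φ x) := by
    have : V x - V (reflectAt l x) = μ * φ x := by
      have : w x = V (reflectAt l x) - V x := rfl
      linarith
    rw [this]; ring
  have h4 := mul_lt_mul_of_pos_left hc2 hμpos
  linarith

/-- The reflected difference cannot vanish at an interior point of the cap if it is nonnegative
on the cap. -/
theorem ne_zero_of_nonneg (h : IsSemilinearSolution Ω ψ G V) {l : ℝ} (hl : l < 0)
    (hnn : ∀ y ∈ Ω, y 0 < l → V y ≤ V (reflectAt l y)) {x : EuclideanSpace ℝ (Fin N)}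
    (hx : x ∈ Ω) (hxl : x 0 < l) : V (reflectAt l x) ≠ V x := by
  intro hxw
  set e : EuclideanSpace ℝ (Fin N) := EuclideanSpace.single 0 1 with he
  set γ : ℝ → EuclideanSpace ℝ (Fin N) := fun t => x + t • e with hγ
  have hγc : Continuous γ := by simp only [hγ]; fun_prop
  have hγ0 : ∀ t, γ t 0 = x 0 + t := fun t => by simp [hγ, he]
  have hγf : ∀ s t, SameFiber (γ s) (γ t) := fun s t j hj => by simp [hγ, he, hj]
  set w : EuclideanSpace ℝ (Fin N) → ℝ := fun y => V (reflectAt l y) - V y with hw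
  have hwc : Continuous w :=
    (h.continuous.comp (contDiff_reflectAt (n := 0) l).continuous).sub h.continuous
  obtain ⟨R, hR⟩ := h.isBounded.exists_norm_le
  set S : Set ℝ := {t | t ≤ 0 ∧ γ t ∈ Ω ∧ w (γ t) = 0} with hS
  have hSne : S.Nonempty := ⟨0, le_rfl, by simpa [hγ] using hx, by simp [hγ, hw, hxw]⟩
  have hSbdd : BddBelow S := ⟨-R - x 0, fun t ht => by
    have := (abs_le.1 ((PiLp.norm_apply_le (γ t) 0).trans (hR _ ht.2.1))).1
    rw [hγ0] at this
    linarith⟩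
  set τ := sInf S with hτ
  have hτ0 : τ ≤ 0 := csInf_le_of_le hSbdd hSne.some_mem hSne.some_mem.1
  have hτcl : τ ∈ closure S := csInf_mem_closure hSne hSbdd
  have hwτ : w (γ τ) = 0 :=
    closure_minimal (fun t ht => ht.2.2)
      (isClosed_eq (hwc.comp hγc) continuous_const) hτcl
  have hτl : γ τ 0 < l := by rw [hγ0]; linarith
  by_cases hmem : γ τ ∈ Ω
  · have hU : IsOpen (Ω ∩ {y : EuclideanSpace ℝ (Fin N) | y 0 < l}) :=
      h.isOpen.inter (isOpen_lt (by fun_prop) continuous_const)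
    have hev := eventually_eq_zero_of_superharmonic (w := w) hU
      (fun y hy => h.contDiffAt_sub hl hy.1 hy.2)
      (fun y hy => sub_nonneg.2 (hnn y hy.1 hy.2))
      (fun y hy => (h.coordLaplacian_sub_le hl hy.1 hy.2).trans
        (mul_nonpos_of_nonneg_of_nonpos (h.weight_nonneg y)
          (sub_nonpos.2 (h.reaction_mono _ _ (h.nonneg y) (hnn y hy.1 hy.2)))))
      ⟨hmem, hτl⟩ hwτ
    have hev' : ∀ᶠ t in 𝓝 τ, w (γ t) = 0 ∧ γ t ∈ Ω :=
      hγc.continuousAt.eventually (hev.and (h.isOpen.mem_nhds hmem))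
    obtain ⟨t, ⟨ht1, ht2⟩, ht3⟩ := ((hev'.filter_mono nhdsWithin_le_nhds).and
      (self_mem_nhdsWithin : Iio τ ∈ 𝓝[<] τ)).exists
    have : τ ≤ t := csInf_le hSbdd ⟨(le_of_lt ht3).trans hτ0, ht2, ht1⟩
    exact this.not_gt ht3
  · have hV0 : V (reflectAt l (γ τ)) = 0 := by
      have : w (γ τ) = V (reflectAt l (γ τ)) - V (γ τ) := rfl
      rw [hwτ, h.eq_zero _ hmem] at this
      linarith
    -- The mirror image of `γ τ` is strictly closer to `{x₁ = 0}` than `γ τ`, hence than nearby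
    -- points of the fibre that do lie in `Ω`; so it lies in `Ω`.
    have hev : ∀ᶠ t in 𝓝 τ, x 0 + t < 2 * l - (x 0 + τ) ∧ x 0 + t < -(2 * l - (x 0 + τ)) := by
      rw [hγ0] at hτl
      refine ((by fun_prop : Continuous fun t : ℝ => x 0 + t).continuousAt.eventually_lt
        continuousAt_const (by linarith)).and
        ((by fun_prop : Continuous fun t : ℝ => x 0 + t).continuousAt.eventually_lt
        continuousAt_const (by linarith))
    obtain ⟨t, ⟨ht1, ht2⟩, htS⟩ := (mem_closure_iff_frequently.1 hτcl).and_eventually hev |>.exists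
      |>.imp fun _ h => h.symm
    have : reflectAt l (γ τ) ∈ Ω := by
      refine mem_of_abs_le h.symm h.conv htS.2.1
        (fun j hj => (sameFiber_reflectAt l _ j hj).trans (hγf τ t j hj)) ?_
      rw [reflectAt_apply_zero, hγ0, hγ0, abs_of_neg (by linarith [htS.1] : x 0 + t < 0), abs_le]
      constructor <;> linarith
    exact (h.pos _ this).ne' hV0

/-- The moving plane inequality for all hyperplanes to the left of the origin. -/
theorem le_reflectAt (h : IsSemilinearSolution Ω ψ G V) {l : ℝ} (hl : l < 0)
    {x : EuclideanSpace ℝ (Fin N)} (hx : x ∈ Ω) (hxl : x 0 < l) : V x ≤ V (reflectAt l x) := by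
  by_contra! hlt
  obtain ⟨ε, hε, η, hη, huni⟩ := h.exists_uniform_violation
  set B : Set ℝ := {l | l < 0 ∧ ∃ x ∈ Ω, x 0 < l ∧ V (reflectAt l x) < V x} with hB
  have hBne : B.Nonempty := ⟨l, hl, x, hx, hxl, hlt⟩
  obtain ⟨R, hR⟩ := h.isBounded.exists_norm_le
  have hBbdd : BddBelow B := ⟨-R, fun t ⟨_, y, hy, hyt, _⟩ => by
    have := (abs_le.1 ((PiLp.norm_apply_le y 0).trans (hR y hy))).1
    linarith⟩
  set l₀ := sInf B with hl₀
  have hl₀neg : l₀ < 0 := (csInf_le hBbdd ⟨hl, x, hx, hxl, hlt⟩).trans_lt hl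
  have hFc : Continuous fun q : ℝ × EuclideanSpace ℝ (Fin N) => V (reflectAt q.1 q.2) :=
    h.continuous.comp continuous_reflectAt_uncurry
  have hgood : ∀ y ∈ Ω, y 0 < l₀ → V y ≤ V (reflectAt l₀ y) := by
    intro y hy hyl
    have hlim : Tendsto (fun t => V (reflectAt t y)) (𝓝[<] l₀) (𝓝 (V (reflectAt l₀ y))) :=
      ((hFc.comp (Continuous.prodMk_left y)).tendsto l₀).mono_left nhdsWithin_le_nhds
    refine ge_of_tendsto hlim ?_
    filter_upwards [Ioo_mem_nhdsLT hyl] with t ht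
    by_contra! hc
    exact (csInf_le hBbdd (show t ∈ B from ⟨ht.2.trans hl₀neg, y, hy, ht.1, hc⟩)).not_gt ht.2
  obtain ⟨s, -, hs, hsB⟩ := exists_seq_tendsto_sInf hBne hBbdd
  -- The uniform bounds keep the limit of these points off the plane and, because `V ≥ η > 0` there,
  -- inside `Ω`.
  choose y hyΩ hy1 hy2 hy3 using fun n => huni (s n) (hsB n).1 (hsB n).2
  obtain ⟨z, -, σ, hσ, hz⟩ := h.isBounded.isCompact_closure.tendsto_subseq
    (fun n => subset_closure (hyΩ n))
  have hsσ : Tendsto (fun n => s (σ n)) atTop (𝓝 l₀) := hs.comp hσ.tendsto_atTop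
  have hz0 : z 0 ≤ l₀ - ε := by
    have hc : Continuous fun q : EuclideanSpace ℝ (Fin N) => q 0 := by fun_prop
    exact le_of_tendsto_of_tendsto' ((hc.tendsto z).comp hz) (hsσ.sub_const ε)
      fun n => hy1 (σ n)
  have hVz : η ≤ V z := ge_of_tendsto' ((h.continuous.tendsto z).comp hz) fun n => hy2 (σ n)
  have hzw : V (reflectAt l₀ z) ≤ V z :=
    le_of_tendsto_of_tendsto' ((hFc.tendsto (l₀, z)).comp (hsσ.prodMk_nhds hz))
      ((h.continuous.tendsto z).comp hz) fun n => (hy3 (σ n)).le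
  have hzΩ : z ∈ Ω := by
    by_contra hn
    rw [h.eq_zero z hn] at hVz
    linarith
  have hzl : z 0 < l₀ := by linarith
  exact h.ne_zero_of_nonneg hl₀neg hgood hzΩ hzl (le_antisymm hzw (hgood z hzΩ hzl))

theorem le_reflectFirst (h : IsSemilinearSolution Ω ψ G V) {x : EuclideanSpace ℝ (Fin N)}
    (hx : x ∈ Ω) (hx0 : x 0 < 0) : V x ≤ V (reflectFirst x) := by
  rw [← reflectAt_zero]
  have hFc : Continuous fun q : ℝ × EuclideanSpace ℝ (Fin N) => V (reflectAt q.1 q.2) :=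
    h.continuous.comp continuous_reflectAt_uncurry
  have hlim : Tendsto (fun t => V (reflectAt t x)) (𝓝[<] 0) (𝓝 (V (reflectAt 0 x))) :=
    ((hFc.comp (Continuous.prodMk_left x)).tendsto 0).mono_left nhdsWithin_le_nhds
  refine ge_of_tendsto hlim ?_
  filter_upwards [Ioo_mem_nhdsLT hx0] with t ht
  exact h.le_reflectAt ht.2 hx ht.1

/-- The hypotheses are invariant under the reflection, so the one-sided inequality also holds in the
reverse direction. -/
theorem comp_reflectFirst (h : IsSemilinearSolution Ω ψ G V) :
    IsSemilinearSolution Ω ψ G (fun x => V (reflectFirst x)) where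
  isOpen := h.isOpen
  isBounded := h.isBounded
  symm := h.symm
  conv := h.conv
  weight_continuous := h.weight_continuous
  weight_nonneg := h.weight_nonneg
  weight_even := h.weight_even
  weight_mono := h.weight_mono
  reaction_nonneg := h.reaction_nonneg
  reaction_mono := h.reaction_mono
  reaction_lip := h.reaction_lip
  reaction_small := h.reaction_small
  continuous := by
    simp only [← reflectAt_zero]
    exact h.continuous.comp (contDiff_reflectAt (n := 0) 0).continuous
  eq_zero x hx := h.eq_zero _ fun hm => hx (by
    have := h.symm _ hm
    rwa [reflectFirst_reflectFirst] at this)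
  pos x hx := h.pos _ (h.symm x hx)
  contDiffAt x hx := by
    simp only [← reflectAt_zero]
    exact (h.contDiffAt _ (by rw [reflectAt_zero]; exact h.symm x hx)).comp x
      (contDiff_reflectAt 0).contDiffAt
  equation x hx := by
    have := h.equation _ (h.symm x hx)
    simp only [← reflectAt_zero] at this ⊢
    rw [coordLaplacian_comp_reflectAt, this, reflectAt_zero, h.weight_even]

theorem reflectFirst_eq (h : IsSemilinearSolution Ω ψ G V) {x : EuclideanSpace ℝ (Fin N)}
    (hx : x ∈ Ω) : V (reflectFirst x) = V x := by
  have key : ∀ y ∈ Ω, y 0 < 0 → V (reflectFirst y) = V y := fun y hy hy0 => by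
    have h1 := h.comp_reflectFirst.le_reflectFirst hy hy0
    simp only [reflectFirst_reflectFirst] at h1
    exact le_antisymm h1 (h.le_reflectFirst hy hy0)
  rcases lt_trichotomy (x 0) 0 with h0 | h0 | h0
  · exact key x hx h0
  · rw [← reflectAt_zero, reflectAt_of_eq h0]
  · have := key _ (h.symm x hx) (by simpa [reflectFirst] using h0)
    rw [reflectFirst_reflectFirst] at this
    exact this.symm

end IsSemilinearSolution

end

/-! ### One-variable estimates for the change of unknown and the reaction term -/

theorem exists_primitive_and_inverse {b : ℝ → ℝ} (hb : Continuous b) (hb1 : ∀ s, 1 ≤ b s) :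
    ∃ A B : ℝ → ℝ, (∀ s, HasDerivAt A (b s) s) ∧ A 0 = 0 ∧
      (∀ s t, s ≤ t → t - s ≤ A t - A s) ∧ (∀ s, B (A s) = s) ∧ ∀ t, A (B t) = t := by
  set A : ℝ → ℝ := fun s => ∫ t in (0 : ℝ)..s, b t with hA
  have hd : ∀ s, HasDerivAt A (b s) s := fun s => (hb.integral_hasStrictDerivAt 0 s).hasDerivAt
  have h0 : A 0 = 0 := by simp [hA]
  have hdiff : Differentiable ℝ A := fun s => (hd s).differentiableAt
  -- `A` expands distances because `b ≥ 1`; this gives bijectivity, and later the Lipschitz bound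
  -- for the inverse.
  have hexp : ∀ s t, s ≤ t → t - s ≤ A t - A s := fun s t hst => by
    have := mul_sub_le_image_sub_of_le_deriv hdiff (C := 1)
      (fun s => by rw [(hd s).deriv]; exact hb1 s) hst
    linarith
  have hmono : StrictMono A := fun s t hst => by
    have := hexp s t hst.le
    linarith
  have htop : Tendsto A atTop atTop := by
    refine tendsto_atTop_mono' atTop ?_ tendsto_id
    filter_upwards [eventually_ge_atTop 0] with t ht
    have := hexp 0 t ht
    simp only [id]; linarith
  have hbot : Tendsto A atBot atBot := by
    refine tendsto_atBot_mono' atBot ?_ tendsto_id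
    filter_upwards [eventually_le_atBot 0] with t ht
    have := hexp t 0 ht
    simp only [id]; linarith
  have hsurj : Function.Surjective A := hdiff.continuous.surjective htop hbot
  exact ⟨A, Function.surjInv hsurj, hd, h0, hexp,
    Function.leftInverse_surjInv ⟨hmono.injective, hsurj⟩, Function.surjInv_eq hsurj⟩

section

variable {k p : ℝ}

theorem rpow_sub_rpow_le (hp : 1 ≤ p) {s t M : ℝ} (hs : 0 ≤ s) (hst : s ≤ t) (htM : t ≤ M) :
    t ^ p - s ^ p ≤ p * M ^ (p - 1) * (t - s) := by
  have hd : ∀ x : ℝ, HasDerivAt (fun x : ℝ => x ^ p) (p * x ^ (p - 1)) x := fun x =>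
    Real.hasDerivAt_rpow_const (Or.inr hp)
  refine (convex_Icc 0 M).image_sub_le_mul_sub_of_deriv_le (f := fun x : ℝ => x ^ p)
    (fun x _ => (hd x).continuousAt.continuousWithinAt)
    (fun x _ => (hd x).differentiableAt.differentiableWithinAt) (fun x hx => ?_)
    s ⟨hs, hst.trans htM⟩ t ⟨hs.trans hst, htM⟩ hst
  rw [interior_Icc] at hx
  rw [(hd x).deriv]
  have : x ^ (p - 1) ≤ M ^ (p - 1) := Real.rpow_le_rpow hx.1.le hx.2.le (by linarith)
  exact mul_le_mul_of_nonneg_left this (by linarith)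

theorem sqrt_one_add_abs_rpow_pos (k s : ℝ) : 0 < √(1 + |s| ^ k) := by positivity

theorem rpow_div_sqrt_mono (hk : 0 ≤ k) (hp : k ≤ p) {s t : ℝ} (hs : 0 ≤ s) (hst : s ≤ t) :
    s ^ p / √(1 + |s| ^ k) ≤ t ^ p / √(1 + |t| ^ k) := by
  have ht : 0 ≤ t := hs.trans hst
  have hkey : s ^ p * √(1 + |t| ^ k) ≤ t ^ p * √(1 + |s| ^ k) := by
    rw [abs_of_nonneg hs, abs_of_nonneg ht]
    refine le_of_sq_le_sq ?_ (by positivity)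
    rw [mul_pow, mul_pow, Real.sq_sqrt (by positivity), Real.sq_sqrt (by positivity)]
    have h1 : s ^ p ≤ t ^ p := Real.rpow_le_rpow hs hst (by linarith)
    have h2 : s ^ (p - k) ≤ t ^ (p - k) := Real.rpow_le_rpow hs hst (by linarith)
    have hadd : ∀ r : ℝ, 0 ≤ r → r ^ p = r ^ (p - k) * r ^ k := fun r hr => by
      rw [← Real.rpow_add_of_nonneg hr (by linarith) hk]; ring_nf
    have h3 : s ^ p * t ^ k ≤ t ^ p * s ^ k := by
      rw [hadd s hs, hadd t ht]
      have := mul_le_mul_of_nonneg_right h2 (by positivity : 0 ≤ s ^ k * t ^ k)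
      linarith
    have h4 : s ^ p * (s ^ p * t ^ k) ≤ t ^ p * (t ^ p * s ^ k) := by gcongr
    have h5 : (s ^ p) ^ 2 ≤ (t ^ p) ^ 2 := by gcongr
    linarith
  rw [div_le_div_iff₀ (sqrt_one_add_abs_rpow_pos k s) (sqrt_one_add_abs_rpow_pos k t)]
  exact hkey

/-- The denominator is nondecreasing and at least one, so it can only reduce the increment of the
power. -/
theorem rpow_div_sqrt_sub_le (hk : 0 ≤ k) (hp : 1 ≤ p) {s t M : ℝ} (hs : 0 ≤ s) (hst : s ≤ t)
    (htM : t ≤ M) : t ^ p / √(1 + |t| ^ k) - s ^ p / √(1 + |s| ^ k) ≤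
      p * M ^ (p - 1) * (t - s) := by
  have ht : 0 ≤ t := hs.trans hst
  refine le_trans ?_ (rpow_sub_rpow_le hp hs hst htM)
  have h1 : √(1 + |s| ^ k) ≤ √(1 + |t| ^ k) := by
    rw [abs_of_nonneg hs, abs_of_nonneg ht]; gcongr
  have h2 : s ^ p / √(1 + |t| ^ k) ≤ s ^ p / √(1 + |s| ^ k) :=
    div_le_div_of_nonneg_left (by positivity) (sqrt_one_add_abs_rpow_pos k s) h1
  have h3 : (t ^ p - s ^ p) / √(1 + |t| ^ k) ≤ t ^ p - s ^ p := by
    refine div_le_self (sub_nonneg.2 (Real.rpow_le_rpow hs hst (by linarith))) ?_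
    rw [Real.one_le_sqrt]
    have : 0 ≤ |t| ^ k := by positivity
    linarith
  rw [sub_div] at h3
  linarith

theorem continuous_sqrt_one_add_abs_rpow (hk : 0 ≤ k) :
    Continuous fun s : ℝ => √(1 + |s| ^ k) :=
  (continuous_const.add (continuous_abs.rpow_const fun _ => Or.inr hk)).sqrt

theorem contDiffOn_one_add_abs_rpow {n : WithTop ℕ∞} :
    ContDiffOn ℝ n (fun s : ℝ => 1 + |s| ^ k) (Ioi 0) := by
  have h : ContDiffOn ℝ n (fun s : ℝ => 1 + s ^ k) (Ioi 0) :=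
    contDiffOn_const.add (contDiffOn_id.rpow_const_of_ne fun s hs => (ne_of_gt hs : s ≠ 0))
  exact h.congr fun s hs => by rw [abs_of_pos hs]

end

/-! ### From the quasi-linear to the semilinear equation -/

section

variable {N : ℕ}

theorem hasDerivAt_line {W : EuclideanSpace ℝ (Fin N) → ℝ} {x e : EuclideanSpace ℝ (Fin N)}
    {t : ℝ} (hW : DifferentiableAt ℝ W (x + t • e)) :
    HasDerivAt (fun t : ℝ => W (x + t • e)) (fderiv ℝ W (x + t • e) e) t := by
  have h : HasDerivAt (fun t : ℝ => x + t • e) e t := by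
    simpa using ((hasDerivAt_id t).smul_const e).const_add x
  exact hW.hasFDerivAt.comp_hasDerivAt t h

theorem gradient_apply_eq (u : EuclideanSpace ℝ (Fin N) → ℝ) (x : EuclideanSpace ℝ (Fin N))
    (j : Fin N) : gradient u x j = fderiv ℝ u x (EuclideanSpace.single j 1) := by
  have h : inner ℝ (gradient u x) (EuclideanSpace.single j (1 : ℝ)) =
      fderiv ℝ u x (EuclideanSpace.single j 1) := by
    simp [gradient]
  rw [← h, EuclideanSpace.inner_single_right]
  simp

/-- One computation serves twice: `c = √a` gives the second derivatives of `A ∘ u`, and `c = a`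
gives the terms of the divergence. -/
theorem hasDerivAt_line_mul_fderiv {c : ℝ → ℝ} {c' : ℝ} {u : EuclideanSpace ℝ (Fin N) → ℝ}
    {x : EuclideanSpace ℝ (Fin N)} (hu : ContDiffAt ℝ 2 u x) (hc : HasDerivAt c c' (u x))
    (e : EuclideanSpace ℝ (Fin N)) :
    HasDerivAt (fun t : ℝ => c (u (x + t • e)) * fderiv ℝ u (x + t • e) e)
      (c' * fderiv ℝ u x e ^ 2 + c (u x) * fderiv ℝ (fun y => fderiv ℝ u y e) x e) 0 := by
  have h1 : HasDerivAt (fun t : ℝ => u (x + t • e)) (fderiv ℝ u x e) 0 := by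
    simpa using hasDerivAt_line (x := x) (e := e) (t := 0)
      (by simpa using hu.differentiableAt (by norm_num))
  have hfd : DifferentiableAt ℝ (fun y => fderiv ℝ u y e) x :=
    ((hu.fderiv_right (m := 1) (by norm_num)).differentiableAt (by norm_num)).clm_apply
      (differentiableAt_const e)
  have h2 : HasDerivAt (fun t : ℝ => fderiv ℝ u (x + t • e) e)
      (fderiv ℝ (fun y => fderiv ℝ u y e) x e) 0 := by
    simpa using hasDerivAt_line (W := fun y => fderiv ℝ u y e) (x := x) (e := e) (t := 0)
      (by simpa using hfd)
  have h3 : HasDerivAt (fun t : ℝ => c (u (x + t • e))) (c' * fderiv ℝ u x e) 0 :=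
    HasDerivAt.comp (0 : ℝ) (by simpa using hc) h1
  refine (h3.mul h2).congr_deriv ?_
  simp only [zero_smul, add_zero]
  ring

theorem secondPartial_comp {A b : ℝ → ℝ} {b' : ℝ} {u : EuclideanSpace ℝ (Fin N) → ℝ}
    {x : EuclideanSpace ℝ (Fin N)} (hu : ContDiffAt ℝ 2 u x) (hA : ∀ s, HasDerivAt A (b s) s)
    (hb : HasDerivAt b b' (u x)) (j : Fin N) :
    secondPartial (fun y => A (u y)) j x =
      b' * fderiv ℝ u x (EuclideanSpace.single j 1) ^ 2 + b (u x) *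
        fderiv ℝ (fun y => fderiv ℝ u y (EuclideanSpace.single j 1)) x
          (EuclideanSpace.single j 1) := by
  refine iteratedDeriv_two_eq_of_hasDerivAt ?_ (hasDerivAt_line_mul_fderiv hu hb _)
  have hev : ∀ᶠ y in 𝓝 x, DifferentiableAt ℝ u y :=
    (hu.eventually (by simp)).mono fun y hy => hy.differentiableAt (by norm_num)
  filter_upwards [(tendsto_line x (EuclideanSpace.single j (1 : ℝ))).eventually hev] with t ht
  exact (hA _).comp t (hasDerivAt_line ht)

theorem fderiv_smul_gradient_apply {a : ℝ → ℝ} {a' : ℝ} {u : EuclideanSpace ℝ (Fin N) → ℝ}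
    {x : EuclideanSpace ℝ (Fin N)} (hu : ContDiffAt ℝ 2 u x) (ha : HasDerivAt a a' (u x))
    (j : Fin N) :
    fderiv ℝ (fun y => (a (u y) • gradient u y) j) x (EuclideanSpace.single j 1) =
      a' * fderiv ℝ u x (EuclideanSpace.single j 1) ^ 2 + a (u x) *
        fderiv ℝ (fun y => fderiv ℝ u y (EuclideanSpace.single j 1)) x
          (EuclideanSpace.single j 1) := by
  simp only [PiLp.smul_apply, smul_eq_mul, gradient_apply_eq]
  have hfd : DifferentiableAt ℝ (fun y => fderiv ℝ u y (EuclideanSpace.single j 1)) x :=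
    ((hu.fderiv_right (m := 1) (by norm_num)).differentiableAt (by norm_num)).clm_apply
      (differentiableAt_const _)
  have hF : DifferentiableAt ℝ
      (fun y => a (u y) * fderiv ℝ u y (EuclideanSpace.single j 1)) x :=
    (ha.differentiableAt.comp x (hu.differentiableAt (by norm_num))).mul hfd
  have h1 := hasDerivAt_line (x := x) (e := EuclideanSpace.single j (1 : ℝ)) (t := 0)
    (by simpa using hF)
  simp only [zero_smul, add_zero] at h1
  exact h1.unique (hasDerivAt_line_mul_fderiv hu ha _)

/-- The change of unknown `V = A(u)` with `A' = √a` turns the quasi-linear operator into the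
Laplacian. -/
theorem sqrt_mul_coordLaplacian_comp {a A : ℝ → ℝ} {u : EuclideanSpace ℝ (Fin N) → ℝ}
    {x : EuclideanSpace ℝ (Fin N)} (hu : ContDiffAt ℝ 2 u x)
    (ha : DifferentiableAt ℝ a (u x)) (hpos : 0 < a (u x))
    (hA : ∀ s, HasDerivAt A (√(a s)) s) :
    √(a (u x)) * -coordLaplacian (fun y => A (u y)) x = quasilinearOp a u x := by
  unfold quasilinearOp divergence coordLaplacian
  rw [EuclideanSpace.norm_sq_eq]
  simp only [fderiv_smul_gradient_apply hu ha.hasDerivAt,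
    secondPartial_comp hu hA (ha.hasDerivAt.sqrt hpos.ne'), gradient_apply_eq, Real.norm_eq_abs,
    sq_abs, Finset.sum_add_distrib, ← Finset.mul_sum]
  set S := ∑ j : Fin N, fderiv ℝ u x (EuclideanSpace.single j 1) ^ 2
  set T := ∑ j : Fin N, fderiv ℝ (fun y => fderiv ℝ u y (EuclideanSpace.single j 1)) x
    (EuclideanSpace.single j 1)
  have hb : √(a (u x)) * √(a (u x)) = a (u x) := Real.mul_self_sqrt hpos.le
  have hb0 : √(a (u x)) ≠ 0 := (Real.sqrt_pos.2 hpos).ne'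
  -- The factor `√a` turns `(√a)'` into `a' / 2`, exactly what remains of the divergence term `a'
  -- |Du|²` after the lower-order term is added.
  have h1 : √(a (u x)) * -(deriv a (u x) / (2 * √(a (u x))) * S + √(a (u x)) * T) =
      -(deriv a (u x) / 2 * S) - √(a (u x)) * √(a (u x)) * T := by
    field_simp
    ring
  rw [h1, hb]
  ring

theorem exists_isSemilinearSolution [NeZero N] {Ω : Set (EuclideanSpace ℝ (Fin N))}
    (hΩ_open : IsOpen Ω) (hΩ_bdd : Bornology.IsBounded Ω)
    (hΩ_symm : ∀ x ∈ Ω, reflectFirst x ∈ Ω) (hΩ_conv : ConvexInFirst Ω)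
    {k p : ℝ} (hk : 1 < k) (hp : k + 1 < p) {ψ : EuclideanSpace ℝ (Fin N) → ℝ}
    (hψ_cont : Continuous ψ) (hψ_nonneg : ∀ x, 0 ≤ ψ x)
    (hψ_even : ∀ x, ψ (reflectFirst x) = ψ x)
    (hψ_mono : MonotoneInFirstOn ψ {x ∈ Ω | x 0 < 0})
    {u : EuclideanSpace ℝ (Fin N) → ℝ}
    (hu : IsPositiveSolution Ω (fun s => 1 + |s| ^ k) (fun x s => ψ x * s ^ p) u) :
    ∃ A G : ℝ → ℝ, Function.Injective A ∧
      IsSemilinearSolution Ω ψ G (Ω.indicator fun x => A (u x)) := by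
  have hk0 : 0 ≤ k := by linarith
  have hp1 : 1 ≤ p := by linarith
  obtain ⟨A, B, hA, hA0, hAexp, hBA, hAB⟩ :=
    exists_primitive_and_inverse (continuous_sqrt_one_add_abs_rpow hk0) fun s => by
      rw [Real.one_le_sqrt]
      have : 0 ≤ |s| ^ k := by positivity
      linarith
  have hAmono : StrictMono A := fun s t hst => by
    have := hAexp s t hst.le
    linarith
  have hAc : Continuous A :=
    (show Differentiable ℝ A from fun s => (hA s).differentiableAt).continuous
  have hBmono : ∀ s t, s ≤ t → B s ≤ B t := fun s t hst => by
    rwa [← hAmono.le_iff_le, hAB, hAB]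
  have hBlip : ∀ s t, s ≤ t → B t - B s ≤ t - s := fun s t hst => by
    have := hAexp _ _ (hBmono s t hst)
    rwa [hAB, hAB] at this
  have hB0 : B 0 = 0 := by simpa [hA0] using hBA 0
  have hBnn : ∀ s, 0 ≤ s → 0 ≤ B s := fun s hs => by
    rw [← hB0]; exact hBmono _ _ hs
  have hBle : ∀ s, 0 ≤ s → B s ≤ s := fun s hs => by
    have := hBlip 0 s hs
    linarith
  -- Regularity on the positive half-line suffices, as `u > 0` in `Ω`.
  have hAC2 : ContDiffOn ℝ 2 A (Ioi 0) := by
    rw [show (2 : WithTop ℕ∞) = 1 + 1 by norm_num, contDiffOn_succ_iff_deriv_of_isOpen isOpen_Ioi]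
    refine ⟨fun s _ => (hA s).differentiableAt.differentiableWithinAt, by simp, ?_⟩
    rw [funext fun s => (hA s).deriv]
    exact contDiffOn_one_add_abs_rpow.sqrt fun s _ => by positivity
  set g : ℝ → ℝ := fun s => s ^ p / √(1 + |s| ^ k) with hg
  have hlip : ∀ M, 0 ≤ M → ∀ s t, 0 ≤ s → s ≤ t → t ≤ M →
      g (B t) - g (B s) ≤ p * M ^ (p - 1) * (t - s) := fun M hM s t hs hst htM =>
    (rpow_div_sqrt_sub_le hk0 hp1 (hBnn s hs) (hBmono s t hst)
      ((hBle t (hs.trans hst)).trans htM)).trans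
      (mul_le_mul_of_nonneg_left (hBlip s t hst) (by positivity))
  have huC : ∀ x ∈ Ω, ContDiffAt ℝ 2 u x := fun x hx =>
    hu.contDiffOn.contDiffAt (hΩ_open.mem_nhds hx)
  have hev : ∀ x ∈ Ω, Ω.indicator (fun x => A (u x)) =ᶠ[𝓝 x] fun x => A (u x) := fun x hx => by
    filter_upwards [hΩ_open.mem_nhds hx] with y hy using indicator_of_mem hy _
  refine ⟨A, fun s => g (B s), hAmono.injective, ?_⟩
  exact
    { isOpen := hΩ_open
      isBounded := hΩ_bdd
      symm := hΩ_symm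
      conv := hΩ_conv
      weight_continuous := hψ_cont
      weight_nonneg := hψ_nonneg
      weight_even := hψ_even
      weight_mono := hψ_mono
      reaction_nonneg := fun s hs =>
        div_nonneg (Real.rpow_nonneg (hBnn s hs) p) (Real.sqrt_nonneg _)
      reaction_mono := fun s t hs hst =>
        rpow_div_sqrt_mono hk0 (by linarith) (hBnn s hs) (hBmono s t hst)
      reaction_lip := fun M => ⟨p * max M 0 ^ (p - 1), fun s t hs hst htM =>
        hlip _ (le_max_right _ _) s t hs hst (htM.trans (le_max_left _ _))⟩
      reaction_small := fun δ hδ => by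
        -- The solution `η` of `p η^(p - 1) = δ`.
        refine ⟨(δ / p) ^ (p - 1)⁻¹, by positivity, fun s t hs hst ht => ?_⟩
        refine (hlip _ (by positivity) s t hs hst ht).trans_eq ?_
        rw [← Real.rpow_mul (by positivity), inv_mul_cancel₀ (by linarith), Real.rpow_one]
        field_simp
      continuous := by
        refine continuous_indicator (fun x hx => ?_) (hAc.comp_continuousOn hu.continuousOn)
        rw [hu.boundary x hx, hA0]
      eq_zero := fun x hx => indicator_of_notMem hx _
      pos := fun x hx => by
        rw [indicator_of_mem hx, ← hA0]
        exact hAmono (hu.pos x hx)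
      contDiffAt := fun x hx =>
        (((hAC2.contDiffAt (Ioi_mem_nhds (hu.pos x hx))).comp x (huC x hx))).congr_of_eventuallyEq
          (hev x hx)
      equation := fun x hx => by
        have hupos := hu.pos x hx
        have hapos : 0 < 1 + |u x| ^ k := by positivity
        have hL := sqrt_mul_coordLaplacian_comp (a := fun s => 1 + |s| ^ k) (huC x hx)
          ((contDiffOn_one_add_abs_rpow (n := 1)).contDiffAt (Ioi_mem_nhds hupos)
            |>.differentiableAt (by norm_num)) hapos hA
        rw [hu.equation x hx] at hL
        rw [coordLaplacian_congr (hev x hx), indicator_of_mem hx, hBA]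
        have hs := sqrt_one_add_abs_rpow_pos k (u x)
        simp only [hg]
        rw [← mul_div_assoc, eq_div_iff hs.ne', mul_comm]
        exact hL }

end

/-! ### Conclusion for the original unknown -/

theorem mainTheorem4 {N : ℕ} [NeZero N] (hN : 2 ≤ N)
    (Ω : Set (EuclideanSpace ℝ (Fin N)))
    (hΩ_open : IsOpen Ω) (hΩ_conn : IsConnected Ω) (hΩ_bdd : Bornology.IsBounded Ω)
    (hΩ_zero : (0 : EuclideanSpace ℝ (Fin N)) ∈ Ω)
    (hΩ_symm : ∀ x ∈ Ω, reflectFirst x ∈ Ω)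
    (hΩ_conv : ConvexInFirst Ω)
    (k p : ℝ) (hk : 1 < k) (hp : k + 1 < p)
    (ψ : EuclideanSpace ℝ (Fin N) → ℝ)
    (hψ_cont : Continuous ψ) (hψ_nonneg : ∀ x, 0 ≤ ψ x)
    (hψ_even : ∀ x, ψ (reflectFirst x) = ψ x)
    (hψ_mono : MonotoneInFirstOn ψ {x ∈ Ω | x 0 < 0})
    (u : EuclideanSpace ℝ (Fin N) → ℝ)
    (hu : IsPositiveSolution Ω (fun s => 1 + |s| ^ k) (fun x s => ψ x * s ^ p) u) :
    ∀ x ∈ closure Ω, u (reflectFirst x) = u x := by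
  obtain ⟨A, G, hAinj, hV⟩ := exists_isSemilinearSolution hΩ_open hΩ_bdd hΩ_symm hΩ_conv hk hp
    hψ_cont hψ_nonneg hψ_even hψ_mono hu
  intro x hx
  by_cases hxΩ : x ∈ Ω
  · have := hV.reflectFirst_eq hxΩ
    rw [indicator_of_mem (hΩ_symm x hxΩ), indicator_of_mem hxΩ] at this
    exact hAinj this
  · have hc : Continuous (reflectFirst : EuclideanSpace ℝ (Fin N) → EuclideanSpace ℝ (Fin N)) := by
      rw [← funext reflectAt_zero]
      exact (contDiff_reflectAt (n := 0) 0).continuous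
    -- The reflection maps boundary points to boundary points, and `u` vanishes at both.
    have hx' : reflectFirst x ∈ closure Ω := map_mem_closure hc hx hΩ_symm
    have hxΩ' : reflectFirst x ∉ Ω := fun h => hxΩ (by
      have := hΩ_symm _ h
      rwa [reflectFirst_reflectFirst] at this)
    rw [hu.boundary x (by rw [hΩ_open.frontier_eq]; exact ⟨hx, hxΩ⟩),
      hu.boundary _ (by rw [hΩ_open.frontier_eq]; exact ⟨hx', hxΩ'⟩)]
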